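/- Let $n\ge 0$ be an integer and let $$\mathcal U^n=\{z=(z',z_{n+1})\in\mathbb C^n\times\mathbb C:\ \operatorname{Im} z_{n+1}>|z'|^2\}$$ be the Siegel upper half-space, equipped with Lebesgue measure $dV$ on $\mathbb C^{n+1}$. Put $$\boldsymbol\rho(z,w)=\tfrac i2(\bar w_{n+1}-z_{n+1})-z'\cdot\overline{w'},\qquad K(z,w)=\frac{(n+1)!}{4\pi^{n+1}}\,\boldsymbol\rho(z,w)^{-n-2},$$ so that $K$ is the Bergman kernel of $\mathcal U^n$, and let $$(Bf)(z)=\int_{\mathcal U^n}\frac{|K(z,w)|^2}{K(z,z)}\,f(w)\,dV(w),\qquad z\in\mathcal U^n,$$ be the Berezin transform. Let $1<p\le\infty$. Then for every complex-valued $f\in L^p(\mathcal U^n)$ the integral defining $(Bf)(z)$ converges absolutely for every $z\in\mathcal U^n$, one has $Bf\in L^p(\mathcal U^n)$, and $$\|B\|_{p\to p}:=\sup\left\{\frac{\|Bf\|_p}{\|f\|_p}:\ f\in L^p(\mathcal U^n),\ f\ne 0\right\}=\frac{\pi}{p\sin\frac{\pi}{p}}\prod_{k=1}^{n+1}\left(1+\frac1{kp}\right),$$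 where for $p=\infty$ the right-hand side is read as $1$. -/

import Mathlib

open MeasureTheory
open scoped ENNReal

noncomputable section

namespace Siegel

/-- The space `ℂ^{n+1} = ℂ^n × ℂ`, with points `z = (z', z_{n+1})`; its `volume` is the
(product) Lebesgue measure. -/
abbrev Space (n : ℕ) : Type := (Fin n → ℂ) × ℂ

/-- The Siegel upper half-space `{z : Im z_{n+1} > |z'|²}`, with `|z'|` the Euclidean norm. -/
def upperHalf (n : ℕ) : Set (Space n) :=
  {z | ∑ j, ‖z.1 j‖ ^ 2 < z.2.im}

/-- Lebesgue measure on the Siegel upper half-space. -/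
abbrev vol (n : ℕ) : Measure (Space n) := volume.restrict (upperHalf n)

/-- `ρ(z, w) = (i/2) (conj w_{n+1} - z_{n+1}) - z' · conj w'`. -/
def rho {n : ℕ} (z w : Space n) : ℂ :=
  Complex.I / 2 * (starRingEnd ℂ w.2 - z.2) - ∑ j, z.1 j * starRingEnd ℂ (w.1 j)

/-- The Bergman kernel of the Siegel upper half-space. -/
def bergmanKernel {n : ℕ} (z w : Space n) : ℂ :=
  (((n + 1).factorial : ℂ) / (4 * (Real.pi : ℂ) ^ (n + 1))) * rho z w ^ (-(n : ℤ) - 2)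

/-- The integral kernel `|K(z, w)|² / K(z, z)` of the Berezin transform. -/
def berezinKernel {n : ℕ} (z w : Space n) : ℂ :=
  ((‖bergmanKernel z w‖ ^ 2 : ℝ) : ℂ) / bergmanKernel z z

/-- The Berezin transform `(B f)(z) = ∫ |K(z, w)|² / K(z, z) f(w) dV(w)`. -/
def berezin {n : ℕ} (f : Space n → ℂ) (z : Space n) : ℂ :=
  ∫ w, berezinKernel z w * f w ∂(vol n)

/-- `sup {‖T f‖_p / ‖f‖_p : f ∈ L^p, f ≠ 0}`, in `[0, ∞]`, for a transformation `T` of functions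
on the Siegel upper half-space. -/
def opNorm {n : ℕ} (p : ℝ≥0∞) (T : (Space n → ℂ) → (Space n → ℂ)) : ℝ≥0∞ :=
  ⨆ (f : Space n → ℂ) (_ : MemLp f p (vol n)) (_ : ¬ f =ᵐ[vol n] 0),
    eLpNorm (T f) p (vol n) / eLpNorm f p (vol n)

end Siegel

end

namespace Siegel

/-! A group of affine automorphisms acts simply transitively on the half-space. In coordinates `(t,
ζ, v)` with `t` the height `Im z_{n+1} - |z'|²`, it identifies the half-space with a solvable group,
and the invariance of the kernel (`ofReal_baseKernel_eq`) turns `B` into an average of right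
translates: `(Bf)(α) = ∫ k(ω) f(αω) dω`, where `k` is the kernel at the identity `(1, 0, 0)`.

Right translation by `ω` divides Lebesgue measure integrals by the height `t` of `ω`
(`lintegral_groupMul_right`), so it scales the `L^p` norm by `t^{-1/p}`. Minkowski's inequality,
carried out as a weighted Hölder estimate in `lintegral_rpow_baseKernel_le`, bounds the norm by `∫
k(ω) t^{-1/p} dω`. Gamma integrals evaluate this (`lintegral_baseKernel_mul_rpow`), and the
reflection formula gives the stated product.

The bound is sharp because `t^{-1/p}` is formally an eigenfunction of `B` with this eigenvalue. Cut
off to `e^{-m} < t < 1` and a ball, it belongs to `L^p`. In the variable `-log t / m` a fixed right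
translation becomes negligible as `m → ∞`, and Fatou's lemma, applied once in the group and once in
the rescaled variables, recovers the full constant. For `p = ∞` the kernel has mass one and the
constant function `1` is extremal. -/

/-! ### Gamma, Gaussian and rational integrals -/

lemma lintegral_rpow_mul_exp_neg_mul {a r : ℝ} (ha : 0 < a) (hr : 0 < r) :
    ∫⁻ t in Set.Ioi (0 : ℝ), ENNReal.ofReal (t ^ (a - 1) * Real.exp (-(r * t))) =
      ENNReal.ofReal ((1 / r) ^ a * Real.Gamma a) := by
  rw [← Real.integral_rpow_mul_exp_neg_mul_Ioi ha hr]
  refine (ofReal_integral_eq_lintegral_ofReal ?_ ?_).symm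
  -- A non-integrable function has Bochner integral `0`, so the nonzero value already proves
  -- integrability.
  · refine Integrable.of_integral_ne_zero ?_
    rw [Real.integral_rpow_mul_exp_neg_mul_Ioi ha hr]
    have := Real.Gamma_pos_of_pos ha
    positivity
  · filter_upwards [ae_restrict_mem measurableSet_Ioi] with t ht
    have : (0 : ℝ) < t := ht
    positivity

lemma lintegral_exp_neg_mul_sum_sq (n : ℕ) {x : ℝ} (hx : 0 < x) :
    ∫⁻ ζ : Fin n → ℂ, ENNReal.ofReal (Real.exp (-(x * ∑ j, ‖ζ j‖ ^ 2))) =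
      ENNReal.ofReal ((Real.pi / x) ^ n) := by
  have h : ∫ ζ : Fin n → ℂ, Real.exp (-(x * ∑ j, ‖ζ j‖ ^ 2)) = (Real.pi / x) ^ n := by
    have := integral_fintype_prod_volume_eq_pow (ι := Fin n)
      (fun ζ : ℂ => Real.exp (-x * ‖ζ‖ ^ 2))
    rw [GaussianFourier.integral_rexp_neg_mul_sq_norm hx, Complex.finrank_real_complex] at this
    simp only [Nat.cast_ofNat, ne_eq, OfNat.ofNat_ne_zero, not_false_eq_true, div_self,
      Real.rpow_one, Fintype.card_fin] at this
    rw [← this]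
    congr with ζ
    rw [← Real.exp_sum, Finset.mul_sum, ← Finset.sum_neg_distrib]
    simp
  rw [← h]
  refine (ofReal_integral_eq_lintegral_ofReal ?_ ?_).symm
  · refine Integrable.of_integral_ne_zero ?_
    rw [h]
    positivity
  · exact ae_of_all _ fun ζ => (Real.exp_pos _).le

lemma integrable_inv_one_add_sq_pow (k : ℕ) :
    Integrable (fun v : ℝ => ((1 + v ^ 2) ^ (k + 1))⁻¹) := by
  refine integrable_inv_one_add_sq.mono' (by fun_prop) (ae_of_all _ fun v => ?_)
  rw [Real.norm_of_nonneg (by positivity)]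
  refine inv_anti₀ (by positivity) (le_self_pow₀ ?_ (by simp))
  nlinarith [sq_nonneg v]

lemma tendsto_mul_inv_one_add_sq_pow (k : ℕ) :
    Filter.Tendsto (fun v : ℝ => v * ((1 + v ^ 2) ^ (k + 1))⁻¹) (Filter.cocompact ℝ) (nhds 0) := by
  rw [tendsto_zero_iff_norm_tendsto_zero]
  refine squeeze_zero (g := fun v : ℝ => ‖v‖⁻¹) (fun v => norm_nonneg _) (fun v => ?_)
    (tendsto_inv_atTop_zero.comp tendsto_norm_cocompact_atTop)
  rcases eq_or_ne v 0 with rfl | hv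
  · simp
  have hv' : 0 < ‖v‖ := norm_pos_iff.2 hv
  rw [norm_mul, norm_inv, Real.norm_of_nonneg (by positivity : (0:ℝ) ≤ (1 + v ^ 2) ^ (k + 1)),
    ← div_eq_mul_inv, div_le_iff₀ (by positivity), inv_mul_eq_div, le_div_iff₀ hv']
  calc ‖v‖ * ‖v‖ = v ^ 2 := by rw [← sq, Real.norm_eq_abs, sq_abs]
    _ ≤ 1 + v ^ 2 := by linarith
    _ ≤ _ := le_self_pow₀ (by nlinarith [sq_nonneg v]) (by simp)

lemma integral_inv_one_add_sq_pow (k : ℕ) :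
    ∫ v : ℝ, ((1 + v ^ 2) ^ (k + 1))⁻¹ =
      Real.pi * (2 * k).factorial / (4 ^ k * (k.factorial : ℝ) ^ 2) := by
  induction k with
  | zero => simp
  | succ k ih =>
    -- This total derivative integrates to zero, which gives the recurrence `(2k+2) I_{k+1} = (2k+1)
    -- I_k`.
    have hd : ∀ v : ℝ, HasDerivAt (fun v : ℝ => v * ((1 + v ^ 2) ^ (k + 1))⁻¹)
        ((2 * k + 2) * ((1 + v ^ 2) ^ (k + 1 + 1))⁻¹ - (2 * k + 1) * ((1 + v ^ 2) ^ (k + 1))⁻¹)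
        v := by
      intro v
      have hp : (1 + v ^ 2) ≠ 0 := by positivity
      have h1 : HasDerivAt (fun v : ℝ => 1 + v ^ 2) (2 * v) v := by
        simpa using (hasDerivAt_pow 2 v).const_add 1
      have h2 := (hasDerivAt_id v).mul ((h1.pow (k + 1)).inv (pow_ne_zero _ hp))
      refine h2.congr_deriv ?_
      simp only [id, Pi.pow_apply, Pi.inv_apply, Nat.add_sub_cancel]
      push_cast
      field_simp
      ring
    have i1 := (integrable_inv_one_add_sq_pow (k + 1)).const_mul (2 * (k : ℝ) + 2)
    have i2 := (integrable_inv_one_add_sq_pow k).const_mul (2 * (k : ℝ) + 1)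
    have h := integral_of_hasDerivAt_of_tendsto hd (i1.sub i2)
      ((tendsto_mul_inv_one_add_sq_pow k).mono_left atBot_le_cocompact)
      ((tendsto_mul_inv_one_add_sq_pow k).mono_left atTop_le_cocompact)
    rw [integral_sub i1 i2, integral_const_mul, integral_const_mul, ih] at h
    have hk : (2 * (k : ℝ) + 2) ≠ 0 := by positivity
    have h' : ∫ v : ℝ, ((1 + v ^ 2) ^ (k + 1 + 1))⁻¹ = (2 * (k : ℝ) + 1) *
        (Real.pi * (2 * k).factorial / (4 ^ k * (k.factorial : ℝ) ^ 2)) / (2 * k + 2) := by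
      rw [eq_div_iff hk]; linarith
    rw [h', show 2 * (k + 1) = 2 * k + 1 + 1 by ring, Nat.factorial_succ, Nat.factorial_succ,
      Nat.factorial_succ]
    have := Nat.factorial_ne_zero k
    push_cast
    field_simp
    ring

lemma lintegral_inv_sq_add_sq_pow (k : ℕ) {A : ℝ} (hA : 0 < A) :
    ∫⁻ v : ℝ, ENNReal.ofReal (((A ^ 2 + v ^ 2) ^ (k + 1))⁻¹) =
      ENNReal.ofReal (Real.pi * (2 * k).factorial / (4 ^ k * (k.factorial : ℝ) ^ 2) *
        (A ^ (2 * k + 1))⁻¹) := by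
  have e : ∀ v : ℝ, ((A ^ 2 + v ^ 2) ^ (k + 1))⁻¹ =
      (A ^ (2 * (k + 1)))⁻¹ * ((1 + (A⁻¹ * v) ^ 2) ^ (k + 1))⁻¹ := by
    intro v
    rw [pow_mul, ← mul_inv, ← mul_pow]
    congr 2
    field_simp
  have hi : Integrable (fun v : ℝ => ((A ^ 2 + v ^ 2) ^ (k + 1))⁻¹) := by
    simp_rw [e]
    exact ((integrable_inv_one_add_sq_pow k).comp_mul_left' (inv_ne_zero hA.ne')).const_mul _
  rw [← ofReal_integral_eq_lintegral_ofReal hi (ae_of_all _ fun v => by positivity)]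
  congr 1
  simp_rw [e]
  rw [integral_const_mul, Measure.integral_comp_mul_left (fun v => ((1 + v ^ 2) ^ (k + 1))⁻¹),
    integral_inv_one_add_sq_pow, inv_inv, abs_of_pos hA, smul_eq_mul,
    show 2 * (k + 1) = 2 * k + 1 + 1 by ring]
  field_simp
  ring

/-- Writing the inverse power as a Gamma integral in an auxiliary variable `x` makes the `t` and `ζ`
integrals factor into a Gamma integral and a Gaussian one. What remains in `x` is again a Gamma
integral. The condition `a < 1` is convergence at `t = 0`. -/
lemma lintegral_lintegral_rpow_mul_inv_pow (n : ℕ) {a : ℝ} (ha : a < 1) (ha' : 0 ≤ a) :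
    ∫⁻ t in Set.Ioi (0 : ℝ), ∫⁻ ζ : Fin n → ℂ,
        ENNReal.ofReal (t ^ (-a) * ((1 + t + ∑ j, ‖ζ j‖ ^ 2) ^ (2 * n + 3))⁻¹) =
      ENNReal.ofReal (Real.Gamma (1 - a) * Real.pi ^ n * Real.Gamma (n + 2 + a) /
        (2 * n + 2).factorial) := by
  have hF : (0 : ℝ) < (2 * n + 2).factorial := by positivity
  have e : ∀ t ∈ Set.Ioi (0 : ℝ), ∀ ζ : Fin n → ℂ,
      ENNReal.ofReal (t ^ (-a) * ((1 + t + ∑ j, ‖ζ j‖ ^ 2) ^ (2 * n + 3))⁻¹) =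
      ∫⁻ x in Set.Ioi (0 : ℝ), ENNReal.ofReal (x ^ ((2 * n + 3 : ℝ) - 1) * Real.exp (-x) /
          (2 * n + 2).factorial) *
        (ENNReal.ofReal (t ^ ((1 - a) - 1) * Real.exp (-(x * t))) *
        ENNReal.ofReal (Real.exp (-(x * ∑ j, ‖ζ j‖ ^ 2)))) := by
    intro t ht ζ
    have ht' : (0 : ℝ) < t := ht
    have hs : (0 : ℝ) ≤ ∑ j, ‖ζ j‖ ^ 2 := Finset.sum_nonneg fun j _ => by positivity
    have hr : (0 : ℝ) < 1 + t + ∑ j, ‖ζ j‖ ^ 2 := by positivity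
    have key := lintegral_rpow_mul_exp_neg_mul (a := 2 * n + 3) (by positivity) hr
    have hG : Real.Gamma (2 * n + 3 : ℝ) = (2 * n + 2).factorial := by
      rw [← Real.Gamma_nat_eq_factorial]; push_cast; ring_nf
    have hp : (1 / (1 + t + ∑ j, ‖ζ j‖ ^ 2)) ^ (2 * n + 3 : ℝ) =
        ((1 + t + ∑ j, ‖ζ j‖ ^ 2) ^ (2 * n + 3))⁻¹ := by
      rw [show (2 * n + 3 : ℝ) = ((2 * n + 3 : ℕ) : ℝ) by push_cast; ring, Real.rpow_natCast,
        one_div, inv_pow]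
    rw [hG, hp] at key
    have h2 : ENNReal.ofReal (t ^ (-a) * ((1 + t + ∑ j, ‖ζ j‖ ^ 2) ^ (2 * n + 3))⁻¹) =
        ENNReal.ofReal (t ^ (-a) / (2 * n + 2).factorial) *
        ENNReal.ofReal (((1 + t + ∑ j, ‖ζ j‖ ^ 2) ^ (2 * n + 3))⁻¹ * (2 * n + 2).factorial) := by
      rw [← ENNReal.ofReal_mul (by positivity)]
      congr 1
      field_simp
    rw [h2, ← key, ← lintegral_const_mul _ (by fun_prop)]
    refine setLIntegral_congr_fun measurableSet_Ioi fun x hx => ?_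
    have hx' : (0 : ℝ) < x := hx
    rw [← ENNReal.ofReal_mul (by positivity), ← ENNReal.ofReal_mul (by positivity),
      ← ENNReal.ofReal_mul (by positivity)]
    congr 1
    rw [show (1 - a - 1) = -a by ring,
      show -((1 + t + ∑ j, ‖ζ j‖ ^ 2) * x) = -x + (-(x * t)) + (-(x * ∑ j, ‖ζ j‖ ^ 2)) by ring,
      Real.exp_add, Real.exp_add]
    ring
  rw [setLIntegral_congr_fun measurableSet_Ioi (fun t ht => lintegral_congr (e t ht))]
  have s1 : ∀ t : ℝ, ∫⁻ ζ : Fin n → ℂ, ∫⁻ x in Set.Ioi (0 : ℝ),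
      ENNReal.ofReal (x ^ ((2 * n + 3 : ℝ) - 1) * Real.exp (-x) / (2 * n + 2).factorial) *
        (ENNReal.ofReal (t ^ ((1 - a) - 1) * Real.exp (-(x * t))) *
        ENNReal.ofReal (Real.exp (-(x * ∑ j, ‖ζ j‖ ^ 2)))) =
      ∫⁻ x in Set.Ioi (0 : ℝ),
      ENNReal.ofReal (x ^ ((2 * n + 3 : ℝ) - 1) * Real.exp (-x) / (2 * n + 2).factorial) *
        (ENNReal.ofReal (t ^ ((1 - a) - 1) * Real.exp (-(x * t))) *
        ENNReal.ofReal ((Real.pi / x) ^ n)) := by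
    intro t
    rw [lintegral_lintegral_swap (by fun_prop)]
    refine setLIntegral_congr_fun measurableSet_Ioi fun x hx => ?_
    rw [lintegral_const_mul _ (by fun_prop), lintegral_const_mul _ (by fun_prop),
      lintegral_exp_neg_mul_sum_sq n hx]
  simp_rw [s1]
  rw [lintegral_lintegral_swap (by fun_prop)]
  have s2 : ∀ x ∈ Set.Ioi (0 : ℝ), ∫⁻ t in Set.Ioi (0 : ℝ),
      ENNReal.ofReal (x ^ ((2 * n + 3 : ℝ) - 1) * Real.exp (-x) / (2 * n + 2).factorial) *
        (ENNReal.ofReal (t ^ ((1 - a) - 1) * Real.exp (-(x * t))) *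
        ENNReal.ofReal ((Real.pi / x) ^ n)) =
      ENNReal.ofReal (Real.Gamma (1 - a) * Real.pi ^ n / (2 * n + 2).factorial) *
        ENNReal.ofReal (x ^ ((n + 2 + a) - 1) * Real.exp (-(1 * x))) := by
    intro x hx
    have hx' : (0 : ℝ) < x := hx
    have hg := Real.Gamma_pos_of_pos (by linarith : 0 < 1 - a)
    rw [lintegral_const_mul _ (by fun_prop), lintegral_mul_const _ (by fun_prop),
      lintegral_rpow_mul_exp_neg_mul (by linarith) hx, ← ENNReal.ofReal_mul (by positivity),
      ← ENNReal.ofReal_mul (by positivity), ← ENNReal.ofReal_mul (by positivity)]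
    congr 1
    -- The factors `x^{1-a}` and `x^n` cancel the scalings of the `t` and `ζ` integrals.
    have : x ^ ((2 * n + 3 : ℝ) - 1) = x ^ ((n + 2 + a) - 1) * x ^ (1 - a) * x ^ n := by
      rw [← Real.rpow_natCast, ← Real.rpow_add hx', ← Real.rpow_add hx']
      congr 1; ring
    rw [this, one_div, Real.inv_rpow hx'.le, one_mul, div_pow]
    field_simp
  rw [setLIntegral_congr_fun measurableSet_Ioi s2, lintegral_const_mul _ (by fun_prop),
    lintegral_rpow_mul_exp_neg_mul (by positivity) one_pos,
    ← ENNReal.ofReal_mul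
      (by have := Real.Gamma_pos_of_pos (by linarith : 0 < 1 - a); positivity)]
  congr 1
  simp
  ring

/-! ### The sharp constant -/

/-- The value `Γ(1 - a) Γ(n + 2 + a) / (n + 1)!` of the integral of the Berezin kernel at the base
point against the power `-a` of the height. -/
noncomputable def berezinMoment (n : ℕ) (a : ℝ) : ℝ :=
  Real.Gamma (1 - a) * Real.Gamma (n + 2 + a) / (n + 1).factorial

lemma Gamma_natCast_add_eq_prod (m : ℕ) {a : ℝ} (ha : 0 < a) :
    Real.Gamma (m + 1 + a) =
      a * Real.Gamma a * m.factorial * ∏ k ∈ Finset.Icc 1 m, (1 + a / k) := by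
  induction m with
  | zero => simp [add_comm (1 : ℝ) a, Real.Gamma_add_one ha.ne']
  | succ m ih =>
    rw [Finset.prod_Icc_succ_top (by omega), show ((m + 1 : ℕ) : ℝ) + 1 + a = (m + 1 + a) + 1 by
      push_cast; ring, Real.Gamma_add_one (by positivity), ih, Nat.factorial_succ]
    push_cast
    field_simp

lemma berezinMoment_zero (n : ℕ) : berezinMoment n 0 = 1 := by
  have h : Real.Gamma (n + 2 : ℝ) = (n + 1).factorial := by
    rw [← Real.Gamma_nat_eq_factorial]; push_cast; ring_nf
  rw [berezinMoment, sub_zero, add_zero, Real.Gamma_one, h, one_mul, div_self (by positivity)]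

/-- The functional equation peels the product off `Γ(n + 2 + 1/p)`; the remaining `Γ(1/p) Γ(1 -
1/p)` is given by the reflection formula. -/
lemma berezinMoment_inv (n : ℕ) {p : ℝ} (hp : 0 < p) :
    berezinMoment n p⁻¹ = Real.pi / (p * Real.sin (Real.pi / p)) *
      ∏ k ∈ Finset.Icc 1 (n + 1), (1 + 1 / ((k : ℝ) * p)) := by
  have h := Gamma_natCast_add_eq_prod (n + 1) (inv_pos.2 hp)
  have h2 := Real.Gamma_mul_Gamma_one_sub p⁻¹
  rw [berezinMoment, show (n : ℝ) + 2 + p⁻¹ = ((n + 1 : ℕ) : ℝ) + 1 + p⁻¹ by push_cast; ring, h]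
  have h3 : ∏ k ∈ Finset.Icc 1 (n + 1), (1 + p⁻¹ / (k : ℝ)) =
      ∏ k ∈ Finset.Icc 1 (n + 1), (1 + 1 / ((k : ℝ) * p)) := by
    refine Finset.prod_congr rfl fun k _ => ?_
    congr 1
    rw [one_div, mul_inv, div_eq_mul_inv, mul_comm]
  rw [h3]
  have h4 : Real.pi / (p * Real.sin (Real.pi / p)) =
      p⁻¹ * (Real.Gamma p⁻¹ * Real.Gamma (1 - p⁻¹)) := by
    rw [h2, ← div_eq_mul_inv]
    simp [div_eq_mul_inv]
    ring
  rw [h4]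
  field_simp

/-! ### Group coordinates and the two translations -/

/-- Coordinates `(t, ζ, v)` on the Siegel upper half-space: height, horizontal part, real part. -/
abbrev Coord (n : ℕ) : Type := ℝ × (Fin n → ℂ) × ℝ

/-- Lebesgue measure on the coordinates of positive height. -/
noncomputable abbrev coordMeasure (n : ℕ) : Measure (Coord n) :=
  (volume.restrict (Set.Ioi (0 : ℝ))).prod volume

/-- The point of `ℂ^n × ℂ` with given coordinates. -/
noncomputable def point {n : ℕ} (α : Coord n) : Space n :=
  (α.2.1, α.2.2 + (α.1 + ∑ j, ‖α.2.1 j‖ ^ 2 : ℝ) * Complex.I)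

/-- The group law of the simply transitive group of affine automorphisms, in coordinates. -/
noncomputable def groupMul {n : ℕ} (α ω : Coord n) : Coord n :=
  (α.1 * ω.1, α.2.1 + √α.1 • ω.2.1,
    α.2.2 + 2 * √α.1 * (∑ j, α.2.1 j * starRingEnd ℂ (ω.2.1 j)).im + α.1 * ω.2.2)

@[fun_prop]
lemma continuous_point {n : ℕ} : Continuous (point (n := n)) := by
  unfold point; fun_prop

@[fun_prop]
lemma measurable_point {n : ℕ} : Measurable (point (n := n)) := continuous_point.measurable

lemma continuous_groupMul {n : ℕ} :
    Continuous (fun x : Coord n × Coord n => groupMul x.1 x.2) := by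
  unfold groupMul; fun_prop

@[fun_prop]
lemma measurable_groupMul {n : ℕ} {β : Type*} [MeasurableSpace β] {f g : β → Coord n}
    (hf : Measurable f) (hg : Measurable g) : Measurable (fun b => groupMul (f b) (g b)) :=
  continuous_groupMul.measurable.comp (hf.prodMk hg)

lemma point_mem_upperHalf {n : ℕ} (α : Coord n) : point α ∈ upperHalf n ↔ 0 < α.1 := by
  simp only [upperHalf, point, Set.mem_ofPred_eq, Complex.add_im, Complex.ofReal_im, zero_add,
    Complex.im_ofReal_mul, Complex.I_im, mul_one, lt_add_iff_pos_left]

lemma measurableSet_upperHalf (n : ℕ) : MeasurableSet (upperHalf n) :=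
  (isOpen_lt (by fun_prop) (by fun_prop)).measurableSet

lemma exists_point_eq {n : ℕ} {z : Space n} (hz : z ∈ upperHalf n) :
    ∃ α : Coord n, 0 < α.1 ∧ point α = z := by
  refine ⟨(z.2.im - ∑ j, ‖z.1 j‖ ^ 2, z.1, z.2.re), sub_pos.2 hz, ?_⟩
  simp only [point, sub_add_cancel, Complex.re_add_im]

lemma lintegral_vol {n : ℕ} {F : Space n → ℝ≥0∞} (hF : Measurable F) :
    ∫⁻ w, F w ∂(vol n) = ∫⁻ α, F (point α) ∂(coordMeasure n) := by
  have hG : Measurable ((upperHalf n).indicator F) := hF.indicator (measurableSet_upperHalf n)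
  rw [← lintegral_indicator (measurableSet_upperHalf n), Measure.volume_eq_prod,
    lintegral_prod _ hG.aemeasurable, lintegral_prod_symm' _ (by fun_prop),
    Measure.volume_eq_prod (Fin n → ℂ) ℝ, lintegral_prod _ (by fun_prop)]
  refine lintegral_congr fun ζ => ?_
  rw [← Complex.volume_preserving_equiv_real_prod.symm.lintegral_comp (by fun_prop),
    Measure.volume_eq_prod, lintegral_prod _ (by fun_prop)]
  refine lintegral_congr fun v => ?_
  -- For fixed `ζ`, passing from imaginary part to height is a translation, so no Jacobian appears.
  rw [← lintegral_add_right_eq_self _ (∑ j, ‖ζ j‖ ^ 2), ← lintegral_indicator measurableSet_Ioi]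
  refine lintegral_congr fun t => ?_
  have e : ((ζ, Complex.measurableEquivRealProd.symm (v, t + ∑ j, ‖ζ j‖ ^ 2)) : Space n) =
      point (t, ζ, v) := by
    refine Prod.ext rfl ?_
    generalize hY : ∑ j, ‖ζ j‖ ^ 2 = Y
    apply Complex.ext <;> simp [point, Complex.measurableEquivRealProd_symm_apply, hY]
  rw [e]
  by_cases ht : 0 < t
  · rw [Set.indicator_of_mem ((point_mem_upperHalf (t, ζ, v)).2 ht), Set.indicator_of_mem]
    exact ht
  · rw [Set.indicator_of_notMem (fun h => ht ((point_mem_upperHalf (t, ζ, v)).1 h)),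
      Set.indicator_of_notMem]
    exact ht

lemma measurePreserving_point (n : ℕ) : MeasurePreserving point (coordMeasure n) (vol n) := by
  refine ⟨measurable_point, Measure.ext_of_lintegral _ fun F hF => ?_⟩
  rw [lintegral_map hF measurable_point, lintegral_vol hF]

lemma ae_coordMeasure_pos (n : ℕ) : ∀ᵐ α ∂(coordMeasure n), 0 < α.1 :=
  Measure.quasiMeasurePreserving_fst.ae (ae_restrict_mem measurableSet_Ioi)

lemma lintegral_comp_add_smul {E : Type*} [NormedAddCommGroup E] [NormedSpace ℝ E]
    [MeasurableSpace E] [BorelSpace E] [FiniteDimensional ℝ E] (μ : Measure E) [μ.IsAddHaarMeasure]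
    {F : E → ℝ≥0∞} (hF : Measurable F) (c : E) {r : ℝ} (hr : 0 < r) :
    ∫⁻ x, F (c + r • x) ∂μ =
      ENNReal.ofReal (r ^ Module.finrank ℝ E)⁻¹ * ∫⁻ x, F x ∂μ := by
  have h := lintegral_map (μ := μ) (f := fun x => F (c + x)) (g := fun x => r • x)
    (by fun_prop) (by fun_prop)
  rw [← h, Measure.map_addHaar_smul μ hr.ne', lintegral_smul_measure,
    lintegral_add_left_eq_self, abs_of_pos (by positivity), smul_eq_mul]

lemma setLIntegral_Ioi_comp_mul {F : ℝ → ℝ≥0∞} (hF : Measurable F) {r : ℝ} (hr : 0 < r) :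
    ∫⁻ x in Set.Ioi 0, F (r * x) = ENNReal.ofReal r⁻¹ * ∫⁻ x in Set.Ioi 0, F x := by
  rw [← lintegral_indicator measurableSet_Ioi, ← lintegral_indicator measurableSet_Ioi]
  have h := lintegral_comp_add_smul volume (hF.indicator (measurableSet_Ioi (a := (0 : ℝ)))) 0 hr
  rw [Module.finrank_self, pow_one] at h
  rw [← h]
  refine lintegral_congr fun x => ?_
  simp [Set.indicator, mul_pos_iff_of_pos_left hr]

lemma lintegral_coordMeasure {n : ℕ} {F : Coord n → ℝ≥0∞} (hF : Measurable F) :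
    ∫⁻ ω, F ω ∂(coordMeasure n) = ∫⁻ t in Set.Ioi (0 : ℝ), ∫⁻ ζ, ∫⁻ v, F (t, ζ, v) := by
  rw [lintegral_prod _ hF.aemeasurable]
  refine lintegral_congr fun t => ?_
  rw [Measure.volume_eq_prod, lintegral_prod _ (by fun_prop)]

/-- The map is triangular: up to translations it dilates `t` and `v` by `s` and the `2n` real
directions of `ζ` by `√s`, with Jacobian `s · s · s^n`. -/
lemma lintegral_groupMul_left {n : ℕ} {F : Coord n → ℝ≥0∞} (hF : Measurable F) {α : Coord n}
    (hα : 0 < α.1) :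
    ∫⁻ ω, F (groupMul α ω) ∂(coordMeasure n) =
      ENNReal.ofReal (α.1 ^ (n + 2))⁻¹ * ∫⁻ ω, F ω ∂(coordMeasure n) := by
  obtain ⟨s, z, x⟩ := α
  have hs : 0 < s := hα
  rw [lintegral_coordMeasure (by fun_prop), lintegral_coordMeasure hF]
  have h1 : ∀ (t : ℝ) (ζ : Fin n → ℂ), ∫⁻ v, F (groupMul (s, z, x) (t, ζ, v)) =
      ENNReal.ofReal s⁻¹ * ∫⁻ v, F (s * t, z + √s • ζ, v) := by
    intro t ζ
    have := lintegral_comp_add_smul volume (F := fun v => F (s * t, z + √s • ζ, v)) (by fun_prop)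
      (x + 2 * √s * (∑ j, z j * starRingEnd ℂ (ζ j)).im) hs
    rw [Module.finrank_self, pow_one] at this
    rw [← this]
    rfl
  have h2 : ∀ t : ℝ, ∫⁻ ζ, ∫⁻ v, F (groupMul (s, z, x) (t, ζ, v)) =
      ENNReal.ofReal s⁻¹ * (ENNReal.ofReal (s ^ n)⁻¹ * ∫⁻ ζ, ∫⁻ v, F (s * t, ζ, v)) := by
    intro t
    simp_rw [h1]
    have hm : Measurable (fun ζ : Fin n → ℂ => ∫⁻ v, F (s * t, ζ, v)) :=
      Measurable.lintegral_prod_right' (f := fun x : (Fin n → ℂ) × ℝ => F (s * t, x.1, x.2))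
        (by fun_prop)
    rw [lintegral_const_mul _ (by fun_prop)]
    congr 1
    rw [lintegral_comp_add_smul volume hm z (Real.sqrt_pos.2 hs)]
    rw [Module.finrank_pi_fintype]
    simp [Complex.finrank_real_complex, mul_comm n 2, pow_mul, Real.sq_sqrt hs.le]
  simp_rw [h2]
  have hm : Measurable (fun t : ℝ => ∫⁻ ζ, ∫⁻ v, F (t, ζ, v)) := by
    have : Measurable (fun x : ℝ × (Fin n → ℂ) => ∫⁻ v, F (x.1, x.2, v)) :=
      Measurable.lintegral_prod_right'
        (f := fun x : (ℝ × (Fin n → ℂ)) × ℝ => F (x.1.1, x.1.2, x.2)) (by fun_prop)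
    exact this.lintegral_prod_right'
  rw [lintegral_const_mul _ (by fun_prop), lintegral_const_mul _ (by fun_prop),
    setLIntegral_Ioi_comp_mul hm hs, ← mul_assoc, ← mul_assoc,
    ← ENNReal.ofReal_mul (by positivity), ← ENNReal.ofReal_mul (by positivity)]
  congr 2
  rw [← mul_inv, ← mul_inv, pow_add]
  congr 1
  ring

/-- As a function of the left factor, the product only shifts the horizontal and real parts; the
height alone is dilated. This exponent, unlike that of left translation, is the source of the weight
`t^{-1/p}`. -/
lemma lintegral_groupMul_right {n : ℕ} {F : Coord n → ℝ≥0∞} (hF : Measurable F) {ω : Coord n}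
    (hω : 0 < ω.1) :
    ∫⁻ α, F (groupMul α ω) ∂(coordMeasure n) =
      ENNReal.ofReal ω.1⁻¹ * ∫⁻ α, F α ∂(coordMeasure n) := by
  obtain ⟨t, ζ, v⟩ := ω
  have ht : 0 < t := hω
  rw [lintegral_coordMeasure (by fun_prop), lintegral_coordMeasure hF]
  have h1 : ∀ (s : ℝ) (z : Fin n → ℂ), ∫⁻ x, F (groupMul (s, z, x) (t, ζ, v)) =
      ∫⁻ x, F (t * s, z + √s • ζ, x) := by
    intro s z
    rw [← lintegral_add_right_eq_self (fun x => F (t * s, z + √s • ζ, x))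
      (2 * √s * (∑ j, z j * starRingEnd ℂ (ζ j)).im + s * v)]
    simp only [groupMul, add_assoc, mul_comm]
  have h2 : ∀ s : ℝ, ∫⁻ z, ∫⁻ x, F (groupMul (s, z, x) (t, ζ, v)) =
      ∫⁻ z, ∫⁻ x, F (t * s, z, x) := by
    intro s
    simp_rw [h1]
    exact lintegral_add_right_eq_self (fun z => ∫⁻ x, F (t * s, z, x)) _
  simp_rw [h2]
  have hm : Measurable (fun t : ℝ => ∫⁻ ζ, ∫⁻ v, F (t, ζ, v)) := by
    have : Measurable (fun x : ℝ × (Fin n → ℂ) => ∫⁻ v, F (x.1, x.2, v)) :=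
      Measurable.lintegral_prod_right'
        (f := fun x : (ℝ × (Fin n → ℂ)) × ℝ => F (x.1.1, x.1.2, x.2)) (by fun_prop)
    exact this.lintegral_prod_right'
  rw [setLIntegral_Ioi_comp_mul hm ht]

/-! ### The Berezin kernel as a convolution kernel -/

/-- The Berezin kernel at the base point, in coordinates. -/
noncomputable def baseKernel {n : ℕ} (ω : Coord n) : ℝ :=
  4 ^ (n + 1) * (n + 1).factorial / Real.pi ^ (n + 1) *
    (((1 + ω.1 + ∑ j, ‖ω.2.1 j‖ ^ 2) ^ 2 + ω.2.2 ^ 2) ^ (n + 2))⁻¹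

lemma baseKernel_nonneg {n : ℕ} (ω : Coord n) : 0 ≤ baseKernel ω := by
  unfold baseKernel; positivity

@[fun_prop]
lemma measurable_baseKernel {n : ℕ} : Measurable (baseKernel (n := n)) := by
  unfold baseKernel; fun_prop

lemma lintegral_baseKernel_mul_rpow (n : ℕ) {a : ℝ} (ha : a < 1) (ha' : 0 ≤ a) :
    ∫⁻ ω : Coord n, ENNReal.ofReal (baseKernel ω * ω.1 ^ (-a)) ∂(coordMeasure n) =
      ENNReal.ofReal (berezinMoment n a) := by
  rw [lintegral_coordMeasure (by fun_prop)]
  set c : ℝ := 4 ^ (n + 1) * (n + 1).factorial / Real.pi ^ (n + 1) with hc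
  set W : ℝ := Real.pi * (2 * (n + 1)).factorial / (4 ^ (n + 1) * ((n + 1).factorial : ℝ) ^ 2)
    with hW
  have hc0 : 0 < c := by positivity
  have hW0 : 0 < W := by positivity
  have h : ∀ t ∈ Set.Ioi (0 : ℝ), ∫⁻ ζ : Fin n → ℂ, ∫⁻ v : ℝ,
      ENNReal.ofReal (baseKernel (t, ζ, v) * t ^ (-a)) =
      ENNReal.ofReal (c * W) * ∫⁻ ζ : Fin n → ℂ,
        ENNReal.ofReal (t ^ (-a) * ((1 + t + ∑ j, ‖ζ j‖ ^ 2) ^ (2 * n + 3))⁻¹) := by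
    intro t ht
    have ht' : (0 : ℝ) < t := ht
    rw [← lintegral_const_mul _ (by fun_prop)]
    refine lintegral_congr fun ζ => ?_
    have hr : (0 : ℝ) < 1 + t + ∑ j, ‖ζ j‖ ^ 2 := by positivity
    have e : ∀ v : ℝ, ENNReal.ofReal (baseKernel (t, ζ, v) * t ^ (-a)) =
        ENNReal.ofReal (c * t ^ (-a)) *
        ENNReal.ofReal ((((1 + t + ∑ j, ‖ζ j‖ ^ 2) ^ 2 + v ^ 2) ^ (n + 1 + 1))⁻¹) := by
      intro v
      rw [← ENNReal.ofReal_mul (by positivity)]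
      congr 1
      simp only [baseKernel, ← hc]
      ring
    simp_rw [e]
    rw [lintegral_const_mul _ (by fun_prop), lintegral_inv_sq_add_sq_pow _ hr, ← hW,
      ← ENNReal.ofReal_mul (by positivity), ← ENNReal.ofReal_mul (by positivity),
      show 2 * (n + 1) + 1 = 2 * n + 3 by ring]
    congr 1
    ring
  -- Integrating out `v` lowers the power `2(n + 2)` of the remaining factor to `2n + 3`.
  rw [setLIntegral_congr_fun measurableSet_Ioi h, lintegral_const_mul _ (by
    exact Measurable.lintegral_prod_right' (f := fun x : ℝ × (Fin n → ℂ) =>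
      ENNReal.ofReal (x.1 ^ (-a) * ((1 + x.1 + ∑ j, ‖x.2 j‖ ^ 2) ^ (2 * n + 3))⁻¹))
      (by fun_prop)), lintegral_lintegral_rpow_mul_inv_pow n ha ha',
    ← ENNReal.ofReal_mul (by positivity)]
  congr 1
  rw [berezinMoment, hc, hW, show 2 * (n + 1) = 2 * n + 2 by ring]
  have := Real.pi_pos.ne'
  field_simp
  ring

lemma rho_point_self {n : ℕ} (α : Coord n) : rho (point α) (point α) = α.1 := by
  have : ∑ j, α.2.1 j * starRingEnd ℂ (α.2.1 j) = ((∑ j, ‖α.2.1 j‖ ^ 2 : ℝ) : ℂ) := by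
    push_cast
    exact Finset.sum_congr rfl fun j _ => Complex.mul_conj' _
  simp only [rho, point, this, map_add, map_mul, Complex.conj_ofReal, Complex.conj_I]
  push_cast
  linear_combination (-(α.1 : ℂ) - ∑ j, (‖α.2.1 j‖ : ℂ) ^ 2) * Complex.I_sq

lemma rho_point_groupMul {n : ℕ} {α ω : Coord n} (hα : 0 ≤ α.1) :
    rho (point α) (point (groupMul α ω)) =
      (α.1 / 2 : ℝ) * ((1 + ω.1 + ∑ j, ‖ω.2.1 j‖ ^ 2 : ℝ) + ω.2.2 * Complex.I) := by
  obtain ⟨s, z, x⟩ := α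
  obtain ⟨t, ζ, v⟩ := ω
  have hs : √s * √s = s := Real.mul_self_sqrt hα
  have e1 : ∑ j, ‖z j + (√s : ℂ) * ζ j‖ ^ 2 =
      ∑ j, ‖z j‖ ^ 2 + 2 * √s * (∑ j, z j * starRingEnd ℂ (ζ j)).re + s * ∑ j, ‖ζ j‖ ^ 2 := by
    rw [Complex.re_sum, Finset.mul_sum, Finset.mul_sum, ← Finset.sum_add_distrib,
      ← Finset.sum_add_distrib]
    refine Finset.sum_congr rfl fun j _ => ?_
    simp only [← Complex.normSq_eq_norm_sq, Complex.normSq_apply, Complex.add_re, Complex.mul_re,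
      Complex.ofReal_re, Complex.ofReal_im, Complex.add_im, Complex.mul_im, Complex.conj_re,
      Complex.conj_im]
    linear_combination (ζ j).re ^ 2 * hs + (ζ j).im ^ 2 * hs
  have e2 : ∑ j, z j * starRingEnd ℂ (z j + (√s : ℂ) * ζ j) =
      ((∑ j, ‖z j‖ ^ 2 : ℝ) : ℂ) + √s * ∑ j, z j * starRingEnd ℂ (ζ j) := by
    push_cast
    rw [Finset.mul_sum, ← Finset.sum_add_distrib]
    refine Finset.sum_congr rfl fun j _ => ?_
    rw [← Complex.mul_conj', map_add, map_mul, Complex.conj_ofReal]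
    ring
  have hS : (∑ j, z j * starRingEnd ℂ (ζ j)) =
      ((∑ j, z j * starRingEnd ℂ (ζ j)).re : ℂ) + (∑ j, z j * starRingEnd ℂ (ζ j)).im * Complex.I :=
    (Complex.re_add_im _).symm
  simp only [rho, point, groupMul, Pi.add_apply, Pi.smul_apply, Complex.real_smul, e1, e2]
  generalize (∑ j, z j * starRingEnd ℂ (ζ j)) = S at hS ⊢
  generalize (∑ j, ‖z j‖ ^ 2) = Z
  generalize (∑ j, ‖ζ j‖ ^ 2) = Y
  -- Only the bare inner product is split; the other occurrences are already its real and imaginary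
  -- parts.
  nth_rewrite 3 [hS]
  simp only [map_add, map_mul, Complex.conj_ofReal, Complex.conj_I]
  push_cast
  linear_combination (-(1 / 2 : ℂ)) * (s * t + Z + 2 * √s * S.re + s * Y + s + Z) * Complex.I_sq

lemma berezinKernel_point {n : ℕ} {α : Coord n} (hα : 0 < α.1) (w : Space n) :
    berezinKernel (point α) w = (((n + 1).factorial / (4 * Real.pi ^ (n + 1)) * α.1 ^ (n + 2) *
      ((‖rho (point α) w‖ ^ 2) ^ (n + 2))⁻¹ : ℝ) : ℂ) := by
  have hz : (-(n : ℤ) - 2) = -((n + 2 : ℕ) : ℤ) := by push_cast; ring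
  have hs : (α.1 : ℂ) ≠ 0 := by exact_mod_cast hα.ne'
  have hpi : (Real.pi : ℂ) ≠ 0 := by exact_mod_cast Real.pi_pos.ne'
  have hf : ((n + 1).factorial : ℂ) ≠ 0 := by exact_mod_cast (Nat.factorial_ne_zero _)
  have hn : ‖((n + 1).factorial : ℂ) / (4 * (Real.pi : ℂ) ^ (n + 1))‖ =
      (n + 1).factorial / (4 * Real.pi ^ (n + 1)) := by
    simp [abs_of_pos Real.pi_pos]
  simp only [berezinKernel, bergmanKernel, rho_point_self, hz, zpow_neg, zpow_natCast, norm_mul,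
    norm_inv, norm_pow, hn]
  push_cast
  rw [pow_right_comm]
  field_simp

/-- Kernel invariance: the factor `α.1 ^ (n + 2)` is exactly the Jacobian of left translation. -/
lemma ofReal_baseKernel_eq {n : ℕ} {α ω : Coord n} (hα : 0 < α.1) :
    ENNReal.ofReal (baseKernel ω) = ENNReal.ofReal (α.1 ^ (n + 2)) *
      ‖berezinKernel (point α) (point (groupMul α ω))‖ₑ := by
  rw [berezinKernel_point hα, ← ofReal_norm, Complex.norm_real,
    Real.norm_of_nonneg (by positivity), ← ENNReal.ofReal_mul (by positivity)]
  congr 1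
  have h : ‖rho (point α) (point (groupMul α ω))‖ ^ 2 =
      (α.1 / 2) ^ 2 * ((1 + ω.1 + ∑ j, ‖ω.2.1 j‖ ^ 2) ^ 2 + ω.2.2 ^ 2) := by
    rw [rho_point_groupMul hα.le, norm_mul, mul_pow, Complex.norm_real, Real.norm_eq_abs, sq_abs,
      ← Complex.normSq_eq_norm_sq, Complex.normSq_add_mul_I]
  rw [h, mul_pow, baseKernel, ← pow_mul, div_pow, show (2 : ℝ) ^ (2 * (n + 2)) = 4 * 4 ^ (n + 1) by
    rw [pow_mul]; norm_num; ring]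
  have := hα.ne'
  have := Real.pi_pos.ne'
  simp only [mul_inv]
  field_simp
  ring

lemma measurable_berezinKernel (n : ℕ) :
    Measurable (fun x : Space n × Space n => berezinKernel x.1 x.2) := by
  unfold berezinKernel bergmanKernel rho
  fun_prop

lemma measurable_berezinKernel_right {n : ℕ} (z : Space n) :
    Measurable (fun w : Space n => berezinKernel z w) := by
  unfold berezinKernel bergmanKernel rho
  fun_prop

lemma lintegral_berezinKernel_mul {n : ℕ} {F : Space n → ℝ≥0∞} (hF : Measurable F) {α : Coord n}
    (hα : 0 < α.1) :
    ∫⁻ w, ‖berezinKernel (point α) w‖ₑ * F w ∂(vol n) =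
      ∫⁻ ω, ENNReal.ofReal (baseKernel ω) * F (point (groupMul α ω)) ∂(coordMeasure n) := by
  have hk := measurable_berezinKernel_right (point α)
  have hm : Measurable fun w => ‖berezinKernel (point α) w‖ₑ * F w := hk.enorm.mul hF
  have hm' : Measurable fun ω => ‖berezinKernel (point α) (point ω)‖ₑ * F (point ω) :=
    hm.comp measurable_point
  have h := lintegral_groupMul_left hm' hα
  rw [lintegral_vol hm]
  simp_rw [ofReal_baseKernel_eq hα, mul_assoc]
  rw [lintegral_const_mul' _ _ ENNReal.ofReal_ne_top, h, ← mul_assoc,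
    ← ENNReal.ofReal_mul (by positivity), mul_inv_cancel₀ (by positivity), ENNReal.ofReal_one,
    one_mul]

lemma lintegral_enorm_berezinKernel {n : ℕ} {z : Space n} (hz : z ∈ upperHalf n) :
    ∫⁻ w, ‖berezinKernel z w‖ₑ ∂(vol n) = 1 := by
  obtain ⟨α, hα, rfl⟩ := exists_point_eq hz
  have h := lintegral_berezinKernel_mul (F := fun _ => 1) measurable_const hα
  have h0 := lintegral_baseKernel_mul_rpow n (a := 0) zero_lt_one le_rfl
  simp only [neg_zero, Real.rpow_zero, mul_one, berezinMoment_zero, ENNReal.ofReal_one] at h h0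
  rw [h, h0]

lemma integrable_berezinKernel {n : ℕ} {z : Space n} (hz : z ∈ upperHalf n) :
    Integrable (fun w => berezinKernel z w) (vol n) :=
  ⟨(measurable_berezinKernel_right z).aestronglyMeasurable, by
    rw [HasFiniteIntegral, lintegral_enorm_berezinKernel hz]; exact ENNReal.one_lt_top⟩

/-! ### Absolute convergence and measurability -/

/-- By `Re (z' · conj w') ≤ (|z'|² + |w'|²) / 2`, the real part of `ρ` is at least half the sum of
the heights. Hence the kernel is bounded in `w` for fixed `z`. -/
lemma half_height_le_norm_rho {n : ℕ} {α : Coord n} {w : Space n} (hw : w ∈ upperHalf n) :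
    α.1 / 2 ≤ ‖rho (point α) w‖ := by
  obtain ⟨β, hβ, rfl⟩ := exists_point_eq hw
  refine le_trans ?_ (Complex.re_le_norm _)
  have h : (∑ j, α.2.1 j * starRingEnd ℂ (β.2.1 j)).re ≤
      (∑ j, ‖α.2.1 j‖ ^ 2) / 2 + (∑ j, ‖β.2.1 j‖ ^ 2) / 2 := by
    rw [Complex.re_sum, Finset.sum_div, Finset.sum_div, ← Finset.sum_add_distrib]
    refine Finset.sum_le_sum fun j _ => ?_
    have h1 : (α.2.1 j * starRingEnd ℂ (β.2.1 j)).re ≤ ‖α.2.1 j‖ * ‖β.2.1 j‖ := by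
      refine (Complex.re_le_norm _).trans ?_
      rw [norm_mul, RCLike.norm_conj]
    nlinarith [sq_nonneg (‖α.2.1 j‖ - ‖β.2.1 j‖)]
  have e : (rho (point α) (point β)).re =
      (α.1 + ∑ j, ‖α.2.1 j‖ ^ 2) / 2 + (β.1 + ∑ j, ‖β.2.1 j‖ ^ 2) / 2 -
        (∑ j, α.2.1 j * starRingEnd ℂ (β.2.1 j)).re := by
    simp only [rho, point]
    generalize (∑ j, α.2.1 j * starRingEnd ℂ (β.2.1 j)) = S
    generalize (∑ j, ‖α.2.1 j‖ ^ 2) = Y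
    generalize (∑ j, ‖β.2.1 j‖ ^ 2) = Z
    simp [Complex.mul_re]
    ring
  rw [e]
  linarith

lemma exists_norm_berezinKernel_le {n : ℕ} {z : Space n} (hz : z ∈ upperHalf n) :
    ∃ C : ℝ, ∀ w ∈ upperHalf n, ‖berezinKernel z w‖ ≤ C := by
  obtain ⟨α, hα, rfl⟩ := exists_point_eq hz
  refine ⟨(n + 1).factorial / (4 * Real.pi ^ (n + 1)) * α.1 ^ (n + 2) *
      (((α.1 / 2) ^ 2) ^ (n + 2))⁻¹, fun w hw => ?_⟩
  rw [berezinKernel_point hα, Complex.norm_real, Real.norm_of_nonneg (by positivity)]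
  have := half_height_le_norm_rho (α := α) hw
  gcongr

lemma integrable_berezinKernel_mul {n : ℕ} {p : ℝ≥0∞} (hp : 1 < p) {f : Space n → ℂ}
    (hf : MemLp f p (vol n)) {z : Space n} (hz : z ∈ upperHalf n) :
    Integrable (fun w => berezinKernel z w * f w) (vol n) := by
  rcases eq_or_ne p ∞ with rfl | hp'
  · exact (integrable_berezinKernel hz).mul_of_top_left hf
  obtain ⟨C, hC⟩ := exists_norm_berezinKernel_le hz
  have hr : 1 ≤ p.toReal := by
    simpa using ENNReal.toReal_mono hp' hp.le
  have h1 := hf.integrable_norm_rpow (zero_lt_one.trans hp).ne' hp'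
  refine ((integrable_berezinKernel hz).norm.add (h1.const_mul C)).mono'
    ((measurable_berezinKernel_right z).aestronglyMeasurable.mul hf.1) ?_
  filter_upwards [ae_restrict_mem (measurableSet_upperHalf n)] with w hw
  have hk := hC w hw
  have hf0 := norm_nonneg (f w)
  rw [norm_mul, Pi.add_apply]
  -- Where `|f| ≤ 1` the integrable kernel dominates; elsewhere `|f| ≤ |f|^p` and the kernel is
  -- bounded.
  rcases le_total ‖f w‖ 1 with h | h
  · have : 0 ≤ C * ‖f w‖ ^ p.toReal := mul_nonneg ((norm_nonneg _).trans hk) (by positivity)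
    nlinarith [norm_nonneg (berezinKernel z w)]
  · have h2 : ‖f w‖ ≤ ‖f w‖ ^ p.toReal := Real.self_le_rpow_of_one_le h hr
    have := mul_le_mul hk h2 hf0 ((norm_nonneg _).trans hk)
    linarith [norm_nonneg (berezinKernel z w)]

lemma berezin_congr_ae {n : ℕ} {f g : Space n → ℂ} (h : f =ᵐ[vol n] g) : berezin f = berezin g := by
  ext z
  refine integral_congr_ae ?_
  filter_upwards [h] with w hw
  rw [hw]

lemma aestronglyMeasurable_berezin {n : ℕ} {f : Space n → ℂ} (hf : AEStronglyMeasurable f (vol n)) :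
    AEStronglyMeasurable (berezin f) (vol n) := by
  obtain ⟨g, hg, hfg⟩ := hf
  rw [berezin_congr_ae hfg]
  refine StronglyMeasurable.aestronglyMeasurable ?_
  have : StronglyMeasurable fun x : Space n × Space n => berezinKernel x.1 x.2 * g x.2 :=
    (measurable_berezinKernel n).stronglyMeasurable.mul (hg.comp_measurable measurable_snd)
  exact this.integral_prod_right

/-! ### Upper bound -/

/-- Minkowski's inequality for an average of right translates, obtained from Hölder and Tonelli.
With `W = k t^{-1/r}`, the integrand `k F` splits as `W^{1/q} · W^{1/r} t^{1/r} F`. -/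
lemma lintegral_rpow_baseKernel_le {n : ℕ} {r : ℝ} (hr : 1 < r) {F : Space n → ℝ≥0∞}
    (hF : Measurable F) :
    ∫⁻ α, (∫⁻ ω, ENNReal.ofReal (baseKernel ω) * F (point (groupMul α ω)) ∂(coordMeasure n)) ^ r
        ∂(coordMeasure n) ≤
      ENNReal.ofReal (berezinMoment n r⁻¹) ^ r * ∫⁻ w, F w ^ r ∂(vol n) := by
  have hr0 : 0 < r := zero_lt_one.trans hr
  have hri : 0 < r⁻¹ := inv_pos.2 hr0
  have hq := (Real.HolderConjugate.conjExponent hr).symm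
  set q := r.conjExponent with hqd
  have hq0 : 0 < q := hq.pos
  set W : Coord n → ℝ≥0∞ := fun ω => ENNReal.ofReal (baseKernel ω * ω.1 ^ (-r⁻¹)) with hW
  have hWm : Measurable W := by fun_prop
  have hWi : ∫⁻ ω, W ω ∂(coordMeasure n) = ENNReal.ofReal (berezinMoment n r⁻¹) :=
    lintegral_baseKernel_mul_rpow n (inv_lt_one_of_one_lt₀ hr) hri.le
  have hm : ∀ α, Measurable fun ω => F (point (groupMul α ω)) := fun α => by fun_prop
  have h1 : ∀ α, (∫⁻ ω, ENNReal.ofReal (baseKernel ω) * F (point (groupMul α ω))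
      ∂(coordMeasure n)) ^ r ≤ ENNReal.ofReal (berezinMoment n r⁻¹) ^ (r - 1) *
        ∫⁻ ω, W ω * ENNReal.ofReal ω.1 * F (point (groupMul α ω)) ^ r ∂(coordMeasure n) := by
    intro α
    have hm' := hm α
    have e : ∫⁻ ω, ENNReal.ofReal (baseKernel ω) * F (point (groupMul α ω)) ∂(coordMeasure n) =
        ∫⁻ ω, ((fun ω => W ω ^ (1 / q)) * (fun ω => W ω ^ (1 / r) *
          (ENNReal.ofReal ω.1 ^ (1 / r) * F (point (groupMul α ω))))) ω ∂(coordMeasure n) := by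
      refine lintegral_congr_ae ?_
      filter_upwards [ae_coordMeasure_pos n] with ω hω
      rw [Pi.mul_apply, ← mul_assoc, ← ENNReal.rpow_add_of_nonneg _ _ (by positivity)
        (by positivity), one_div, one_div, hq.inv_add_inv_eq_one, ENNReal.rpow_one, ← mul_assoc,
        ENNReal.ofReal_rpow_of_pos hω, hW, ← ENNReal.ofReal_mul
          (mul_nonneg (baseKernel_nonneg _) (by positivity)), mul_assoc, ← Real.rpow_add hω,
        neg_add_cancel, Real.rpow_zero, mul_one]
    rw [e]
    refine (ENNReal.rpow_le_rpow (ENNReal.lintegral_mul_le_Lp_mul_Lq _ hq (by fun_prop)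
      (by fun_prop)) hr0.le).trans_eq ?_
    rw [ENNReal.mul_rpow_of_nonneg _ _ hr0.le, ← ENNReal.rpow_mul, ← ENNReal.rpow_mul,
      one_div_mul_cancel hr0.ne', ENNReal.rpow_one]
    congr 1
    · simp_rw [← ENNReal.rpow_mul, one_div_mul_cancel hq0.ne', ENNReal.rpow_one]
      rw [hWi]
      congr 1
      rw [hqd, Real.conjExponent]
      field_simp
    · refine lintegral_congr fun ω => ?_
      rw [ENNReal.mul_rpow_of_nonneg _ _ hr0.le, ENNReal.mul_rpow_of_nonneg _ _ hr0.le,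
        ← ENNReal.rpow_mul, ← ENNReal.rpow_mul, one_div_mul_cancel hr0.ne', ENNReal.rpow_one,
        ENNReal.rpow_one, mul_assoc]
  refine (lintegral_mono h1).trans_eq ?_
  rw [lintegral_const_mul _ (by
    exact Measurable.lintegral_prod_right' (f := fun x : Coord n × Coord n =>
      W x.2 * ENNReal.ofReal x.2.1 * F (point (groupMul x.1 x.2)) ^ r) (by fun_prop)),
    lintegral_lintegral_swap (by
      exact Measurable.aemeasurable (f := fun x : Coord n × Coord n =>
        W x.2 * ENNReal.ofReal x.2.1 * F (point (groupMul x.1 x.2)) ^ r) (by fun_prop))]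
  -- The factor `ω.1` left by Hölder cancels the `ω.1⁻¹` of right translation.
  have h2 : ∫⁻ ω, ∫⁻ α, W ω * ENNReal.ofReal ω.1 * F (point (groupMul α ω)) ^ r
      ∂(coordMeasure n) ∂(coordMeasure n) =
      ∫⁻ ω, W ω * ∫⁻ w, F w ^ r ∂(vol n) ∂(coordMeasure n) := by
    refine lintegral_congr_ae ?_
    filter_upwards [ae_coordMeasure_pos n] with ω hω
    have hm1 : Measurable fun α => F (point α) ^ r := by fun_prop
    rw [lintegral_const_mul _ (by fun_prop), lintegral_groupMul_right hm1 hω,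
      lintegral_vol (by fun_prop), mul_assoc, ← mul_assoc (ENNReal.ofReal ω.1),
      ← ENNReal.ofReal_mul hω.le, mul_inv_cancel₀ hω.ne', ENNReal.ofReal_one, one_mul]
  rw [h2, lintegral_mul_const _ hWm, hWi, ← mul_assoc]
  congr 1
  nth_rewrite 2 [← ENNReal.rpow_one (ENNReal.ofReal (berezinMoment n r⁻¹))]
  rw [← ENNReal.rpow_add_of_nonneg _ _ (by linarith) zero_le_one, sub_add_cancel]

lemma enorm_berezin_le {n : ℕ} (f : Space n → ℂ) (z : Space n) :
    ‖berezin f z‖ₑ ≤ ∫⁻ w, ‖berezinKernel z w‖ₑ * ‖f w‖ₑ ∂(vol n) := by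
  refine (enorm_integral_le_lintegral_enorm _).trans_eq ?_
  simp_rw [enorm_mul]

lemma lintegral_enorm_berezin_rpow {n : ℕ} {f : Space n → ℂ} (hf : AEStronglyMeasurable f (vol n))
    (r : ℝ) : ∫⁻ z, ‖berezin f z‖ₑ ^ r ∂(vol n) =
      ∫⁻ α, ‖berezin f (point α)‖ₑ ^ r ∂(coordMeasure n) := by
  have hm := ((aestronglyMeasurable_berezin hf).enorm.pow_const r)
  rw [← (measurePreserving_point n).map_eq] at hm ⊢
  exact lintegral_map' hm measurable_point.aemeasurable

lemma eLpNorm_berezin_le_of_ne_top {n : ℕ} {p : ℝ≥0∞} (hp : 1 < p) (hp' : p ≠ ∞)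
    {f : Space n → ℂ} (hf : AEStronglyMeasurable f (vol n)) :
    eLpNorm (berezin f) p (vol n) ≤
      ENNReal.ofReal (berezinMoment n p.toReal⁻¹) * eLpNorm f p (vol n) := by
  have hr : 1 < p.toReal := by
    simpa using (ENNReal.toReal_lt_toReal ENNReal.one_ne_top hp').2 hp
  have hr0 : 0 < p.toReal := zero_lt_one.trans hr
  obtain ⟨g, hg, hfg⟩ := id hf
  rw [berezin_congr_ae hfg, eLpNorm_congr_ae hfg,
    eLpNorm_eq_lintegral_rpow_enorm_toReal (zero_lt_one.trans hp).ne' hp',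
    eLpNorm_eq_lintegral_rpow_enorm_toReal (zero_lt_one.trans hp).ne' hp',
    lintegral_enorm_berezin_rpow hg.aestronglyMeasurable]
  have h : ∫⁻ α, ‖berezin g (point α)‖ₑ ^ p.toReal ∂(coordMeasure n) ≤
      ENNReal.ofReal (berezinMoment n p.toReal⁻¹) ^ p.toReal *
        ∫⁻ w, ‖g w‖ₑ ^ p.toReal ∂(vol n) := by
    refine le_trans (lintegral_mono_ae ?_) (lintegral_rpow_baseKernel_le hr hg.enorm)
    filter_upwards [ae_coordMeasure_pos n] with α hα
    refine ENNReal.rpow_le_rpow ?_ hr0.le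
    rw [← lintegral_berezinKernel_mul hg.enorm hα]
    exact enorm_berezin_le _ _
  refine (ENNReal.rpow_le_rpow h (by positivity : 0 ≤ 1 / p.toReal)).trans_eq ?_
  rw [ENNReal.mul_rpow_of_nonneg _ _ (by positivity), ← ENNReal.rpow_mul,
    mul_one_div_cancel hr0.ne', ENNReal.rpow_one]

lemma eLpNorm_berezin_top_le {n : ℕ} (f : Space n → ℂ) :
    eLpNorm (berezin f) ∞ (vol n) ≤ eLpNorm f ∞ (vol n) := by
  rw [eLpNorm_exponent_top]
  refine eLpNormEssSup_le_of_ae_enorm_bound ?_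
  filter_upwards [ae_restrict_mem (measurableSet_upperHalf n)] with z hz
  calc ‖berezin f z‖ₑ ≤ ∫⁻ w, ‖berezinKernel z w‖ₑ * ‖f w‖ₑ ∂(vol n) := enorm_berezin_le _ _
    _ ≤ ∫⁻ w, ‖berezinKernel z w‖ₑ * eLpNorm f ∞ (vol n) ∂(vol n) := by
      refine lintegral_mono_ae ?_
      filter_upwards [enorm_ae_le_eLpNormEssSup f (vol n)] with w hw
      rw [eLpNorm_exponent_top]
      gcongr
    _ = eLpNorm f ∞ (vol n) := by
      rw [lintegral_mul_const _ (measurable_berezinKernel_right z).enorm,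
        lintegral_enorm_berezinKernel hz, one_mul]

/-- The kernel is nonnegative, so nothing cancels; `hi` excludes the default value `0` of the
integral. -/
lemma enorm_berezin_eq_of_nonneg {n : ℕ} {g : Space n → ℝ} (hg : ∀ w, 0 ≤ g w) {z : Space n}
    (hz : z ∈ upperHalf n)
    (hi : Integrable (fun w => berezinKernel z w * (g w : ℂ)) (vol n)) :
    ‖berezin (fun w => (g w : ℂ)) z‖ₑ = ∫⁻ w, ‖berezinKernel z w‖ₑ * ‖(g w : ℂ)‖ₑ ∂(vol n) := by
  obtain ⟨α, hα, rfl⟩ := exists_point_eq hz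
  have e : ∀ w, berezinKernel (point α) w * (g w : ℂ) =
      ((‖berezinKernel (point α) w * (g w : ℂ)‖ : ℝ) : ℂ) := by
    intro w
    rw [berezinKernel_point hα, ← Complex.ofReal_mul, Complex.norm_real, Real.norm_of_nonneg]
    exact mul_nonneg (by positivity) (hg w)
  have h1 : berezin (fun w => (g w : ℂ)) (point α) =
      ((∫ w, ‖berezinKernel (point α) w * (g w : ℂ)‖ ∂(vol n) : ℝ) : ℂ) := by
    exact (integral_congr_ae (ae_of_all _ e)).trans integral_ofReal
  rw [h1, ← ofReal_norm, Complex.norm_real,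
    Real.norm_of_nonneg (integral_nonneg fun w => norm_nonneg _),
    ofReal_integral_norm_eq_lintegral_enorm hi]
  simp_rw [enorm_mul]

/-! ### Test functions and lower bound -/

/-- The coordinates of a point of `ℂ^n × ℂ`. -/
noncomputable def coords {n : ℕ} (w : Space n) : Coord n :=
  (w.2.im - ∑ j, ‖w.1 j‖ ^ 2, w.1, w.2.re)

@[fun_prop]
lemma measurable_coords {n : ℕ} : Measurable (coords (n := n)) := by
  unfold coords; fun_prop

lemma coords_point {n : ℕ} (α : Coord n) : coords (point α) = α := by
  obtain ⟨t, ζ, v⟩ := α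
  simp only [coords, point]
  generalize (∑ j, ‖ζ j‖ ^ 2) = Y
  simp

/-- The coordinates with height in `(e^{-m}, 1)` and the other entries in the unit ball. -/
def testRegion (n m : ℕ) : Set (Coord n) :=
  Set.Ioo (Real.exp (-m)) 1 ×ˢ Metric.ball 0 1

lemma isOpen_testRegion (n m : ℕ) : IsOpen (testRegion n m) :=
  isOpen_Ioo.prod Metric.isOpen_ball

/-- The power `-1/r` of the height, cut off to the test region. -/
noncomputable def testFun (n m : ℕ) (r : ℝ) (w : Space n) : ℝ :=
  (testRegion n m).indicator (fun α => α.1 ^ (-r⁻¹)) (coords w)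

lemma measurable_testFun (n m : ℕ) (r : ℝ) : Measurable (testFun n m r) := by
  have : Measurable ((testRegion n m).indicator (fun α : Coord n => α.1 ^ (-r⁻¹))) :=
    Measurable.indicator (by fun_prop) (isOpen_testRegion n m).measurableSet
  exact this.comp measurable_coords

lemma testFun_nonneg (n m : ℕ) (r : ℝ) (w : Space n) : 0 ≤ testFun n m r w := by
  refine Set.indicator_apply_nonneg fun h => ?_
  have : 0 < (coords w).1 := (Real.exp_pos _).trans h.1.1
  positivity

lemma enorm_testFun_point {n m : ℕ} {r : ℝ} (α : Coord n) :
    ‖((testFun n m r (point α) : ℝ) : ℂ)‖ₑ =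
      (testRegion n m).indicator (fun α => ENNReal.ofReal (α.1 ^ (-r⁻¹))) α := by
  rw [← ofReal_norm, Complex.norm_real, Real.norm_of_nonneg (testFun_nonneg _ _ _ _), testFun,
    coords_point]
  by_cases h : α ∈ testRegion n m
  · simp [Set.indicator_of_mem h]
  · simp [Set.indicator_of_notMem h]

/-- Substituting `s = e^{-mv}` turns `ds / s` into `m dv` on a unit interval independent of `m`. -/
lemma setLIntegral_Ioo_exp_neg {m : ℕ} (hm : m ≠ 0) (K : ℝ → ℝ≥0∞) :
    ∫⁻ s in Set.Ioo (Real.exp (-m)) 1, ENNReal.ofReal s⁻¹ * K s =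
      m * ∫⁻ v in Set.Ioo (0 : ℝ) 1, K (Real.exp (-(m * v))) := by
  have hm0 : (0 : ℝ) < m := by exact_mod_cast Nat.pos_of_ne_zero hm
  have him : (fun v : ℝ => Real.exp (-(m * v))) '' Set.Ioo 0 1 = Set.Ioo (Real.exp (-m)) 1 := by
    ext s
    constructor
    · rintro ⟨v, ⟨h0, h1⟩, rfl⟩
      refine ⟨Real.exp_lt_exp.2 (by nlinarith), Real.exp_lt_one_iff.2 (by nlinarith)⟩
    · rintro ⟨h0, h1⟩
      have hs : 0 < s := (Real.exp_pos _).trans h0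
      refine ⟨-Real.log s / m, ⟨div_pos (neg_pos.2 (Real.log_neg hs h1)) hm0, ?_⟩, ?_⟩
      · rw [div_lt_one hm0]
        linarith [(Real.lt_log_iff_exp_lt hs).2 h0]
      · simp only
        rw [mul_div_cancel₀ _ hm0.ne', neg_neg, Real.exp_log hs]
  have hd : ∀ v ∈ Set.Ioo (0 : ℝ) 1, HasDerivWithinAt (fun v : ℝ => Real.exp (-(m * v)))
      (Real.exp (-(m * v)) * (-m)) (Set.Ioo 0 1) v := by
    intro v _
    have : HasDerivAt (fun v : ℝ => -(m * v)) (-m : ℝ) v := by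
      simpa using ((hasDerivAt_id v).const_mul (m : ℝ)).fun_neg
    exact this.exp.hasDerivWithinAt
  have hinj : Set.InjOn (fun v : ℝ => Real.exp (-(m * v))) (Set.Ioo 0 1) := by
    intro a _ b _ h
    have := Real.exp_injective h
    exact mul_left_cancel₀ hm0.ne' (neg_injective this)
  rw [← him, lintegral_image_eq_lintegral_abs_deriv_mul measurableSet_Ioo hd hinj,
    ← lintegral_const_mul' _ _ (ENNReal.natCast_ne_top m)]
  refine lintegral_congr fun v => ?_
  rw [← mul_assoc, ← ENNReal.ofReal_mul (abs_nonneg _), abs_mul, abs_neg, abs_of_pos hm0,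
    abs_of_pos (Real.exp_pos _), mul_right_comm, mul_inv_cancel₀ (Real.exp_pos _).ne', one_mul,
    ENNReal.ofReal_natCast]

lemma coordMeasure_restrict_testRegion (n m : ℕ) :
    (coordMeasure n).restrict (testRegion n m) =
      (volume.restrict (Set.Ioo (Real.exp (-m)) 1)).prod
        (volume.restrict (Metric.ball (0 : (Fin n → ℂ) × ℝ) 1)) := by
  rw [testRegion, ← Measure.prod_restrict, Measure.restrict_restrict measurableSet_Ioo,
    Set.inter_eq_left.2]
  exact fun s hs => (Real.exp_pos _).trans hs.1

lemma setLIntegral_testRegion {n m : ℕ} (hm : m ≠ 0) {K : Coord n → ℝ≥0∞} (hK : Measurable K) :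
    ∫⁻ α in testRegion n m, ENNReal.ofReal α.1⁻¹ * K α ∂(coordMeasure n) =
      m * ∫⁻ x, K (Real.exp (-(m * x.1)), x.2) ∂((volume.restrict (Set.Ioo (0 : ℝ) 1)).prod
        (volume.restrict (Metric.ball (0 : (Fin n → ℂ) × ℝ) 1))) := by
  rw [coordMeasure_restrict_testRegion, lintegral_prod _ (by fun_prop),
    lintegral_prod _ (by fun_prop)]
  simp only
  simp_rw [lintegral_const_mul' _ _ ENNReal.ofReal_ne_top]
  exact setLIntegral_Ioo_exp_neg hm fun s => ∫⁻ y in Metric.ball 0 1, K (s, y)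

lemma lintegral_enorm_testFun_rpow {n m : ℕ} (hm : m ≠ 0) {r : ℝ} (hr : 0 < r) :
    ∫⁻ w, ‖((testFun n m r w : ℝ) : ℂ)‖ₑ ^ r ∂(vol n) =
      m * volume (Metric.ball (0 : (Fin n → ℂ) × ℝ) 1) := by
  have hmeas := measurable_testFun n m r
  rw [lintegral_vol (by fun_prop)]
  have h := setLIntegral_testRegion (n := n) hm (K := fun _ => 1) measurable_const
  simp only [mul_one, lintegral_one, Measure.prod_apply MeasurableSet.univ] at h
  rw [show ∫⁻ α, ‖((testFun n m r (point α) : ℝ) : ℂ)‖ₑ ^ r ∂(coordMeasure n) =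
    ∫⁻ α in testRegion n m, ENNReal.ofReal α.1⁻¹ ∂(coordMeasure n) from ?_, h]
  · simp
  · rw [← lintegral_indicator (isOpen_testRegion n m).measurableSet]
    refine lintegral_congr fun α => ?_
    rw [enorm_testFun_point]
    by_cases h : α ∈ testRegion n m
    · have hα : 0 < α.1 := (Real.exp_pos _).trans h.1.1
      rw [Set.indicator_of_mem h, Set.indicator_of_mem h, ENNReal.ofReal_rpow_of_pos (by positivity),
        ← Real.rpow_mul hα.le, neg_mul, inv_mul_cancel₀ hr.ne', Real.rpow_neg_one]
    · rw [Set.indicator_of_notMem h, Set.indicator_of_notMem h, ENNReal.zero_rpow_of_pos hr]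

/-- The Berezin transform of the test function at `α`, divided by the power `-1/r` of the
height. -/
noncomputable def testTransform (n m : ℕ) (r : ℝ) (α : Coord n) : ℝ≥0∞ :=
  ∫⁻ ω, ENNReal.ofReal (baseKernel ω * ω.1 ^ (-r⁻¹)) *
    (testRegion n m).indicator 1 (groupMul α ω) ∂(coordMeasure n)

lemma measurable_testTransform_integrand (n m : ℕ) (r : ℝ) :
    Measurable (fun x : Coord n × Coord n => ENNReal.ofReal (baseKernel x.2 * x.2.1 ^ (-r⁻¹)) *
      (testRegion n m).indicator (1 : Coord n → ℝ≥0∞) (groupMul x.1 x.2)) := by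
  have : Measurable ((testRegion n m).indicator (1 : Coord n → ℝ≥0∞)) :=
    measurable_one.indicator (isOpen_testRegion n m).measurableSet
  fun_prop

lemma measurable_testTransform_integrand_right (n m : ℕ) (r : ℝ) (α : Coord n) :
    Measurable (fun ω : Coord n => ENNReal.ofReal (baseKernel ω * ω.1 ^ (-r⁻¹)) *
      (testRegion n m).indicator (1 : Coord n → ℝ≥0∞) (groupMul α ω)) := by
  have : Measurable ((testRegion n m).indicator (1 : Coord n → ℝ≥0∞)) :=
    measurable_one.indicator (isOpen_testRegion n m).measurableSet
  fun_prop

lemma measurable_testTransform (n m : ℕ) (r : ℝ) : Measurable (testTransform n m r) :=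
  (measurable_testTransform_integrand n m r).lintegral_prod_right'

/-- The height is multiplicative on the group, so its power `-1/r` factors out of the average. -/
lemma lintegral_berezinKernel_mul_testFun {n m : ℕ} {r : ℝ} {α : Coord n} (hα : 0 < α.1) :
    ∫⁻ w, ‖berezinKernel (point α) w‖ₑ * ‖((testFun n m r w : ℝ) : ℂ)‖ₑ ∂(vol n) =
      ENNReal.ofReal (α.1 ^ (-r⁻¹)) * testTransform n m r α := by
  have hmeas := measurable_testFun n m r
  rw [lintegral_berezinKernel_mul (by fun_prop) hα, testTransform,
    ← lintegral_const_mul' _ _ ENNReal.ofReal_ne_top]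
  refine lintegral_congr_ae ?_
  filter_upwards [ae_coordMeasure_pos n] with ω hω
  rw [enorm_testFun_point]
  by_cases h : groupMul α ω ∈ testRegion n m
  · rw [Set.indicator_of_mem h, Set.indicator_of_mem h, Pi.one_apply, mul_one,
      ← ENNReal.ofReal_mul (baseKernel_nonneg _), ← ENNReal.ofReal_mul (by positivity)]
    congr 1
    simp only [groupMul]
    rw [Real.mul_rpow hα.le hω.le]
    ring
  · rw [Set.indicator_of_notMem h, Set.indicator_of_notMem h, mul_zero, mul_zero, mul_zero]

lemma tendsto_exp_neg_natCast_mul {v : ℝ} (hv : 0 < v) :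
    Filter.Tendsto (fun m : ℕ => Real.exp (-(m * v))) Filter.atTop (nhds 0) :=
  Real.tendsto_exp_neg_atTop_nhds_zero.comp
    (tendsto_natCast_atTop_atTop.atTop_mul_const hv)

/-- As the left height `e^{-mv}` tends to `0`, right multiplication by `ω` moves the other entries
by a vanishing amount, and it shifts `-log t / m` by only `O(1/m)`. Interior points therefore stay
in the region. -/
lemma eventually_groupMul_mem_testRegion {n : ℕ} {v : ℝ} (hv : v ∈ Set.Ioo (0 : ℝ) 1)
    {y : (Fin n → ℂ) × ℝ} (hy : y ∈ Metric.ball 0 1) {ω : Coord n} (hω : 0 < ω.1) :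
    ∀ᶠ m : ℕ in Filter.atTop, groupMul (Real.exp (-(m * v)), y) ω ∈ testRegion n m := by
  have h1 := tendsto_exp_neg_natCast_mul hv.1
  have h2 := tendsto_exp_neg_natCast_mul (sub_pos.2 hv.2)
  have hc : Filter.Tendsto (fun m : ℕ => groupMul (Real.exp (-(m * v)), y) ω) Filter.atTop
      (nhds (groupMul (0, y) ω)) := by
    have : Continuous fun s : ℝ => groupMul (s, y) ω :=
      continuous_groupMul.comp (by fun_prop : Continuous fun s : ℝ => ((s, y), ω))
    exact (this.tendsto 0).comp h1
  have e : groupMul (0, y) ω = (0, y) := by simp [groupMul]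
  rw [e] at hc
  have hc1 := (continuous_fst.tendsto _).comp hc
  have hc2 := (continuous_snd.tendsto _).comp hc
  filter_upwards [hc1.eventually_lt_const zero_lt_one,
    hc2.eventually (Metric.isOpen_ball.mem_nhds hy), h2.eventually_lt_const hω] with m m1 m2 m3
  refine ⟨⟨?_, m1⟩, m2⟩
  -- The lower height bound reduces to `e^{-m(1-v)} < ω.1`.
  have e2 : Real.exp (-(m : ℝ)) = Real.exp (-(m * v)) * Real.exp (-(m * (1 - v))) := by
    rw [← Real.exp_add]; congr 1; ring
  rw [e2]
  exact mul_lt_mul_of_pos_left m3 (Real.exp_pos _)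

lemma ofReal_berezinMoment_le_liminf {n : ℕ} {r : ℝ} (hr : 1 < r) {v : ℝ}
    (hv : v ∈ Set.Ioo (0 : ℝ) 1) {y : (Fin n → ℂ) × ℝ} (hy : y ∈ Metric.ball 0 1) :
    ENNReal.ofReal (berezinMoment n r⁻¹) ≤
      Filter.liminf (fun m : ℕ => testTransform n m r (Real.exp (-(m * v)), y)) Filter.atTop := by
  rw [← lintegral_baseKernel_mul_rpow n (inv_lt_one_of_one_lt₀ hr)
    (inv_pos.2 (zero_lt_one.trans hr)).le]
  refine le_trans (lintegral_mono_ae ?_) (lintegral_liminf_le fun m =>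
    measurable_testTransform_integrand_right n m r _)
  filter_upwards [ae_coordMeasure_pos n] with ω hω
  refine Filter.le_liminf_of_le (by isBoundedDefault) ?_
  filter_upwards [eventually_groupMul_mem_testRegion hv hy hω] with m hm
  simp [Set.indicator_of_mem hm]

lemma memLp_testFun {n m : ℕ} (hm : m ≠ 0) {p : ℝ≥0∞} (hp : 0 < p) (hp' : p ≠ ∞) :
    MemLp (fun w => ((testFun n m p.toReal w : ℝ) : ℂ)) p (vol n) := by
  have hmeas := measurable_testFun n m p.toReal
  refine ⟨by fun_prop, ?_⟩
  rw [eLpNorm_lt_top_iff_lintegral_rpow_enorm_lt_top hp.ne' hp',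
    lintegral_enorm_testFun_rpow hm (ENNReal.toReal_pos hp.ne' hp')]
  exact ENNReal.mul_lt_top (ENNReal.natCast_lt_top m) measure_ball_lt_top

/-- Both `‖f‖^r` and the part of `‖Bf‖^r` carried by the test region acquire a factor `m` in
logarithmic height; it cancels. -/
lemma lintegral_testTransform_rpow_le {n m : ℕ} (hm : m ≠ 0) {p : ℝ≥0∞} (hp : 1 < p) (hp' : p ≠ ∞) :
    ∫⁻ x, testTransform n m p.toReal (Real.exp (-(m * x.1)), x.2) ^ p.toReal
        ∂((volume.restrict (Set.Ioo (0 : ℝ) 1)).prod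
          (volume.restrict (Metric.ball (0 : (Fin n → ℂ) × ℝ) 1))) ≤
      opNorm p (berezin (n := n)) ^ p.toReal * volume (Metric.ball (0 : (Fin n → ℂ) × ℝ) 1) := by
  have hp0 : 0 < p := zero_lt_one.trans hp
  have hr0 : 0 < p.toReal := ENNReal.toReal_pos hp0.ne' hp'
  set r := p.toReal with hr
  set f : Space n → ℂ := fun w => ((testFun n m r w : ℝ) : ℂ) with hf
  have hfL : MemLp f p (vol n) := memLp_testFun hm hp0 hp'
  have hm0 : (m : ℝ≥0∞) ≠ 0 := by exact_mod_cast hm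
  have hV0 : volume (Metric.ball (0 : (Fin n → ℂ) × ℝ) 1) ≠ 0 :=
    (Metric.measure_ball_pos _ _ one_pos).ne'
  have hnorm : eLpNorm f p (vol n) ^ r = m * volume (Metric.ball (0 : (Fin n → ℂ) × ℝ) 1) := by
    rw [eLpNorm_eq_lintegral_rpow_enorm_toReal hp0.ne' hp', ← ENNReal.rpow_mul, ← hr,
      one_div_mul_cancel hr0.ne', ENNReal.rpow_one, lintegral_enorm_testFun_rpow hm hr0]
  have hne : eLpNorm f p (vol n) ≠ 0 := by
    intro h
    rw [h, ENNReal.zero_rpow_of_pos hr0] at hnorm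
    exact mul_ne_zero hm0 hV0 hnorm.symm
  have hf0 : ¬ f =ᵐ[vol n] 0 := fun h => hne (by rw [eLpNorm_congr_ae h, eLpNorm_zero])
  have hop : eLpNorm (berezin f) p (vol n) ≤ opNorm p (berezin (n := n)) * eLpNorm f p (vol n) := by
    rw [← ENNReal.div_le_iff hne hfL.2.ne]
    exact le_iSup_of_le f (le_iSup_of_le hfL (le_iSup_of_le hf0 le_rfl))
  have hop' := ENNReal.rpow_le_rpow hop hr0.le
  rw [ENNReal.mul_rpow_of_nonneg _ _ hr0.le, hnorm,
    eLpNorm_eq_lintegral_rpow_enorm_toReal hp0.ne' hp', ← ENNReal.rpow_mul, ← hr,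
    one_div_mul_cancel hr0.ne', ENNReal.rpow_one, lintegral_enorm_berezin_rpow hfL.1] at hop'
  have hlow : m * ∫⁻ x, testTransform n m r (Real.exp (-(m * x.1)), x.2) ^ r
      ∂((volume.restrict (Set.Ioo (0 : ℝ) 1)).prod
        (volume.restrict (Metric.ball (0 : (Fin n → ℂ) × ℝ) 1))) ≤
      ∫⁻ α, ‖berezin f (point α)‖ₑ ^ r ∂(coordMeasure n) := by
    rw [← setLIntegral_testRegion hm (K := fun α => testTransform n m r α ^ r)
      ((measurable_testTransform n m r).pow_const r)]
    refine le_trans (lintegral_mono_ae ?_) (setLIntegral_le_lintegral (testRegion n m) _)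
    filter_upwards [ae_restrict_mem (isOpen_testRegion n m).measurableSet] with α h
    have hα : 0 < α.1 := (Real.exp_pos _).trans h.1.1
    have hz := (point_mem_upperHalf α).2 hα
    rw [enorm_berezin_eq_of_nonneg (testFun_nonneg n m r) hz (integrable_berezinKernel_mul hp hfL hz),
      lintegral_berezinKernel_mul_testFun hα, ENNReal.mul_rpow_of_nonneg _ _ hr0.le,
      ENNReal.ofReal_rpow_of_pos (by positivity), ← Real.rpow_mul hα.le, neg_mul,
      inv_mul_cancel₀ hr0.ne', Real.rpow_neg_one]
  have h := hlow.trans hop'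
  rw [mul_left_comm] at h
  exact (ENNReal.mul_le_mul_iff_right hm0 (ENNReal.natCast_ne_top m)).1 h

/-- The pointwise lower limit is integrated over the fixed finite measure `ν` by a second use of
Fatou; its positive mass `V` then cancels. -/
lemma le_opNorm_berezin {n : ℕ} {p : ℝ≥0∞} (hp : 1 < p) (hp' : p ≠ ∞) :
    ENNReal.ofReal (berezinMoment n p.toReal⁻¹) ≤ opNorm p (berezin (n := n)) := by
  have hr : 1 < p.toReal := by
    simpa using (ENNReal.toReal_lt_toReal ENNReal.one_ne_top hp').2 hp
  have hr0 : 0 < p.toReal := zero_lt_one.trans hr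
  set r := p.toReal
  set C := ENNReal.ofReal (berezinMoment n r⁻¹) with hC
  set V := volume (Metric.ball (0 : (Fin n → ℂ) × ℝ) 1) with hV
  have hV0 : V ≠ 0 := (Metric.measure_ball_pos _ _ one_pos).ne'
  have hV1 : V ≠ ∞ := measure_ball_lt_top.ne
  set ν := ((volume.restrict (Set.Ioo (0 : ℝ) 1)).prod
          (volume.restrict (Metric.ball (0 : (Fin n → ℂ) × ℝ) 1))) with hν
  have h1 : C ^ r * V = ∫⁻ _, C ^ r ∂ν := by
    rw [lintegral_const, hν, ← Set.univ_prod_univ, Measure.prod_prod]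
    simp [hV]
  have h2 : ∫⁻ _, C ^ r ∂ν ≤ ∫⁻ x, Filter.liminf (fun m : ℕ =>
      testTransform n m r (Real.exp (-(m * x.1)), x.2) ^ r) Filter.atTop ∂ν := by
    refine lintegral_mono_ae ?_
    have hmem : ∀ᵐ x ∂ν, x ∈ Set.Ioo (0 : ℝ) 1 ×ˢ Metric.ball (0 : (Fin n → ℂ) × ℝ) 1 := by
      rw [hν, Measure.prod_restrict]
      exact ae_restrict_mem (measurableSet_Ioo.prod Metric.isOpen_ball.measurableSet)
    filter_upwards [hmem] with x hx
    have h := ofReal_berezinMoment_le_liminf hr hx.1 hx.2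
    have hmap := (ENNReal.monotone_rpow_of_nonneg hr0.le).map_liminf_of_continuousAt
      (F := Filter.atTop) (fun m : ℕ => testTransform n m r (Real.exp (-(m * x.1)), x.2))
      ENNReal.continuous_rpow_const.continuousAt
    exact (ENNReal.rpow_le_rpow h hr0.le).trans_eq hmap
  have h3 := lintegral_liminf_le (μ := ν) (u := Filter.atTop) (f := fun (m : ℕ) x =>
      testTransform n m r (Real.exp (-(m * x.1)), x.2) ^ r) (fun m => by
    have := measurable_testTransform n m r
    fun_prop)
  have h4 : Filter.liminf (fun m : ℕ => ∫⁻ x, testTransform n m r (Real.exp (-(m * x.1)), x.2) ^ r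
      ∂ν) Filter.atTop ≤ opNorm p (berezin (n := n)) ^ r * V := by
    refine Filter.liminf_le_of_frequently_le' (Filter.Eventually.frequently ?_)
    filter_upwards [Filter.eventually_ne_atTop 0] with m hm
    exact lintegral_testTransform_rpow_le hm hp hp'
  have h := h1.trans_le (h2.trans (h3.trans h4))
  rw [ENNReal.mul_le_mul_iff_left hV0 hV1] at h
  exact (ENNReal.rpow_le_rpow_iff hr0).1 h

/-! ### The endpoint and the conclusion -/

lemma opNorm_berezin_le {n : ℕ} {p C : ℝ≥0∞}
    (h : ∀ f : Space n → ℂ, MemLp f p (vol n) →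
      eLpNorm (berezin f) p (vol n) ≤ C * eLpNorm f p (vol n)) :
    opNorm p (berezin (n := n)) ≤ C :=
  iSup_le fun f => iSup_le fun hf => iSup_le fun _ => ENNReal.div_le_of_le_mul (h f hf)

lemma vol_ne_zero (n : ℕ) : vol n ≠ 0 := by
  intro h
  have h1 := lintegral_enorm_berezinKernel ((point_mem_upperHalf ((1, 0, 0) : Coord n)).2 one_pos)
  rw [h, lintegral_zero_measure] at h1
  exact zero_ne_one h1

lemma berezin_one {n : ℕ} {z : Space n} (hz : z ∈ upperHalf n) :
    ‖berezin (fun _ => 1) z‖ₑ = 1 := by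
  have h := enorm_berezin_eq_of_nonneg (g := fun _ => 1) (fun _ => zero_le_one) hz
    (by simpa using integrable_berezinKernel hz)
  simpa [lintegral_enorm_berezinKernel hz] using h

lemma one_le_opNorm_berezin_top (n : ℕ) : 1 ≤ opNorm ∞ (berezin (n := n)) := by
  have h0 := vol_ne_zero n
  have : NeZero (vol n) := ⟨h0⟩
  have e1 : eLpNorm (fun _ : Space n => (1 : ℂ)) ∞ (vol n) = 1 := by
    rw [eLpNorm_const _ (by simp) h0]; simp
  have e2 : eLpNorm (berezin fun _ : Space n => (1 : ℂ)) ∞ (vol n) = 1 := by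
    rw [← e1]
    refine eLpNorm_congr_enorm_ae ?_
    filter_upwards [ae_restrict_mem (measurableSet_upperHalf n)] with z hz
    rw [berezin_one hz, enorm_one]
  refine le_iSup_of_le (fun _ => 1) (le_iSup_of_le (memLp_top_const 1) (le_iSup_of_le ?_ ?_))
  · intro h
    rw [eLpNorm_congr_ae h, eLpNorm_zero] at e1
    exact zero_ne_one e1
  · rw [e1, e2, div_one]

end Siegel

theorem mainTheorem3 (n : ℕ) (p : ℝ≥0∞) (hp : 1 < p) :
    (∀ f : Siegel.Space n → ℂ, MemLp f p (Siegel.vol n) →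
      (∀ z ∈ Siegel.upperHalf n,
        Integrable (fun w => Siegel.berezinKernel z w * f w) (Siegel.vol n)) ∧
      MemLp (Siegel.berezin f) p (Siegel.vol n)) ∧
    Siegel.opNorm p (Siegel.berezin (n := n)) =
      ENNReal.ofReal
        (if p = ∞ then 1
         else Real.pi / (p.toReal * Real.sin (Real.pi / p.toReal)) *
          ∏ k ∈ Finset.Icc 1 (n + 1), (1 + 1 / ((k : ℝ) * p.toReal))) := by
  -- The endpoint is separate because `p.toReal` is `0` at `p = ∞`, where the closed formula would
  -- evaluate to `0`.
  have hbound : ∀ f : Siegel.Space n → ℂ, MemLp f p (Siegel.vol n) →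
      eLpNorm (Siegel.berezin f) p (Siegel.vol n) ≤ ENNReal.ofReal
        (if p = ∞ then 1 else Siegel.berezinMoment n p.toReal⁻¹) * eLpNorm f p (Siegel.vol n) := by
    intro f hf
    split_ifs with h
    · subst h
      simpa using Siegel.eLpNorm_berezin_top_le f
    · exact Siegel.eLpNorm_berezin_le_of_ne_top hp h hf.1
  refine ⟨fun f hf => ⟨fun z hz => Siegel.integrable_berezinKernel_mul hp hf hz,
    Siegel.aestronglyMeasurable_berezin hf.1,
    (hbound f hf).trans_lt (ENNReal.mul_lt_top ENNReal.ofReal_lt_top hf.2)⟩, ?_⟩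
  have hle := Siegel.opNorm_berezin_le hbound
  split_ifs at hle ⊢ with h
  · subst h
    refine le_antisymm hle ?_
    simpa using Siegel.one_le_opNorm_berezin_top n
  · rw [← Siegel.berezinMoment_inv n (ENNReal.toReal_pos (zero_lt_one.trans hp).ne' h)]
    exact le_antisymm hle (Siegel.le_opNorm_berezin hp h)
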